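/- Let $E$ and $F$ be real Banach lattices, with $F$ Dedekind complete (every nonempty subset of $F$ that is bounded above has a supremum), and let $T : E \to F$ be a positive linear operator, i.e. $Tx \ge 0$ whenever $x \ge 0$. A set $A \subseteq E$ is called almost order bounded if for every $\varepsilon > 0$ there is $u \in E$, $u \ge 0$, with $A \subseteq [-u,u] + \varepsilon B_E$, where $[-u,u]=\{x\in E : -u\le x\le u\}$ and $B_E$ is the closed unit ball of $E$; a sequence $(x_n)$ in $E$ is called almost order bounded if the set of its terms is, and disjoint if $|x_m| \wedge |x_n| = 0$ whenever $m \ne n$. The operator $T$ is called almost order-weakly compact if it is norm continuous and $T(A)$ is relatively weakly compact in $F$ (that is, its closure in the weak topology of $F$ is weakly compact) for every almost order bounded set $A \subseteq E$. Then $T$ is almost order-weakly compact if and only if $\|T(x_n)\| \to 0$ for every disjoint almost order bounded sequence $(x_n)$ in $E$. -/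

import Mathlib

open Filter Topology
open scoped Pointwise

/-- A set `A` in a normed lattice is almost order bounded if for every `ε > 0` there is `u ≥ 0`
with `A ⊆ [-u, u] + ε B`, where `B` is the closed unit ball. -/
def IsAlmostOrderBounded {E : Type*} [NormedAddCommGroup E] [Lattice E] [NormedSpace ℝ E]
    (A : Set E) : Prop :=
  ∀ ε : ℝ, 0 < ε → ∃ u : E, 0 ≤ u ∧ A ⊆ Set.Icc (-u) u + ε • Metric.closedBall (0 : E) 1

/-- A subset of a normed space is relatively weakly compact if its closure in the weak topology
is weakly compact. -/
def IsRelativelyWeaklyCompact {F : Type*} [NormedAddCommGroup F] [NormedSpace ℝ F]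
    (B : Set F) : Prop :=
  IsCompact (closure (toWeakSpace ℝ F '' B))

/-- A linear operator is almost order-weakly compact if it is norm continuous and maps every
almost order bounded set to a relatively weakly compact set. -/
def IsAlmostOrderWeaklyCompact {E F : Type*}
    [NormedAddCommGroup E] [Lattice E] [NormedSpace ℝ E]
    [NormedAddCommGroup F] [NormedSpace ℝ F] (T : E →ₗ[ℝ] F) : Prop :=
  Continuous T ∧ ∀ A : Set E, IsAlmostOrderBounded A → IsRelativelyWeaklyCompact (T '' A)

/-- A sequence is disjoint if `|x m| ⊓ |x n| = 0` whenever `m ≠ n`. -/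
def IsDisjointSeq {E : Type*} [AddCommGroup E] [Lattice E] (x : ℕ → E) : Prop :=
  ∀ m n : ℕ, m ≠ n → |x m| ⊓ |x n| = 0

/-- An ordered set is Dedekind complete if every nonempty subset that is bounded above has a
least upper bound. -/
def IsDedekindComplete (F : Type*) [Preorder F] : Prop :=
  ∀ S : Set F, S.Nonempty → BddAbove S → ∃ a : F, IsLUB S a

/-!
The equivalence is mediated by the condition that `T (y n)` tends to zero for every disjoint
sequence `y` in an order interval `[0, u]`. Since truncating `|x n|` at `u` costs little norm for an
almost order bounded sequence, this condition is equivalent to the one about almost order bounded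
disjoint sequences (`tendsto_map_of_isDisjointSeq_of_isAlmostOrderBounded`).

If `T` maps order intervals to relatively weakly compact sets, then the partial sums of a disjoint
sequence in `[0, u]` have images forming a monotone sequence in a relatively weakly compact set.
Such a sequence converges in norm, by Mazur's theorem and the order, so the images of the terms
tend to zero.

For the converse, suppose that `T` maps some almost order bounded set to a set that is not
relatively weakly compact. By Helly's theorem and weak-star compactness there are points `x n` of
the image and functionals `f i` in the dual ball with `f i (x n) > δ` for `i ≤ n` and
`f i (x n) = 0` for `n < i`. Convex combinations preserve this pattern, up to a change of indices, and it is
contradicted by two elements `y`, `y'` of an order interval, satisfying it at indices far apart,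
with `f i (T y)` and `f i (T y')` uniformly close. Three facts produce such elements.

* The inequality `sub_le_two_nsmul_add_sum_inf` bounds `y' - y`, up to a small multiple of `u`, by
  finitely many pieces `(a - y)⁺ ⊓ (y' - a)⁺`. Along a monotone sequence the pieces with fixed `a`
  are disjoint, so that `T`, being small on disjoint sequences of `[0, u]`, maps monotone sequences
  of `[0, u]` to Cauchy sequences
  (`cauchySeq_map_of_monotone`).
* As a consequence, if `G i` are positive functionals dominating the `f i`, then smallness of
  finitely many `G j (T |y' - y|)` implies smallness of all of them
  (`exists_uniform_bound_of_finite_bound`).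
* The same pieces measure the concavity of `y ↦ ∑ j, g (y ⊓ j e)`, so that its near-maximisers
  over a decreasing sequence of convex sets are close with respect to a given positive functional
  `g` (`exists_map_abs_sub_le_of_antitone`).
-/

set_option linter.unusedSectionVars false

/-! ### Inequalities in lattice-ordered groups -/

section LatticeGroup

variable {E : Type*} [AddCommGroup E] [Lattice E] [IsOrderedAddMonoid E]

/-- A lattice substitute for rounding to the nearest grid point: the infimum over `j ≤ k` of
`|m - j e|` is at most `e + (m - k e)⁺`. The infimum is phrased through its lower bounds. -/
lemma le_add_posPart_of_forall_le_abs_sub {e m c : E} (he : 0 ≤ e) (hm : 0 ≤ m) (k : ℕ)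
    (hc : ∀ j ≤ k, c ≤ |m - j • e|) : c ≤ e + (m - k • e)⁺ := by
  induction k with
  | zero =>
    have h := hc 0 le_rfl
    simp only [zero_smul, sub_zero, abs_of_nonneg hm, posPart_of_nonneg hm] at h ⊢
    exact h.trans (le_add_of_nonneg_left he)
  | succ k ih =>
    have h1 := ih fun j hj => hc j (hj.trans (Nat.le_succ k))
    have h2 := hc (k + 1) le_rfl
    set r := m - (k + 1) • e with hr
    have hr' : m - k • e = r + e := by rw [hr, add_smul, one_smul]; abel
    rw [hr'] at h1
    rw [← posPart_add_negPart] at h2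
    -- `c - e - r⁺` lies below the disjoint elements `(r + e)⁺` and `(r + e)⁻`
    have h3 : c - e - r⁺ ≤ (r + e)⁺ := by
      rw [sub_sub, sub_le_iff_le_add, add_comm _ (e + _)]
      exact h1.trans (by rw [add_assoc]; gcongr; exact le_add_of_nonneg_left (posPart_nonneg r))
    have h4 : c - e - r⁺ ≤ (r + e)⁻ := by
      have h5 : r⁻ - e ≤ (r + e)⁻ := by
        rw [negPart_def, sup_sub, negPart_def]
        refine sup_le ?_ ?_
        · exact le_sup_of_le_left (by rw [neg_add, sub_eq_add_neg])
        · exact le_sup_of_le_right (by simpa using he)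
      refine le_trans ?_ h5
      rw [sub_sub, sub_le_iff_le_add]
      exact h2.trans (le_of_eq (by abel))
    have h6 := le_inf h3 h4
    rw [posPart_inf_negPart_eq_zero, sub_sub, sub_nonpos] at h6
    exact h6

/-- On `[0, N e]` the difference `y' - y` is controlled by the pieces
`(j e - y)⁺ ⊓ (y' - j e)⁺`, which for functions live where `y < j e < y'`. This follows from
`2 ((j e - y) ⊓ (y' - j e)) = (y' - y) - |y + y' - 2 j e|` by choosing the grid point nearest to
the midpoint of `y` and `y'`. -/
lemma sub_le_two_nsmul_add_sum_inf {e y y' : E} (he : 0 ≤ e) (N : ℕ) (hy : 0 ≤ y) (hy' : 0 ≤ y')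
    (hyu : y ≤ N • e) (hyu' : y' ≤ N • e) :
    y' - y ≤ 2 • e + 2 • ∑ j ∈ Finset.range (N + 1), (j • e - y)⁺ ⊓ (y' - j • e)⁺ := by
  set S := ∑ j ∈ Finset.range (N + 1), (j • e - y)⁺ ⊓ (y' - j • e)⁺ with hS
  have key : y' - y - 2 • S ≤ 2 • e + (y + y' - N • (2 • e))⁺ := by
    refine le_add_posPart_of_forall_le_abs_sub (nsmul_nonneg he 2) (add_nonneg hy hy') N
      fun j hj => ?_
    have h1 : (j • e - y) ⊓ (y' - j • e) ≤ S :=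
      (inf_le_inf (le_posPart _) (le_posPart _)).trans
        (Finset.single_le_sum (f := fun j => (j • e - y)⁺ ⊓ (y' - j • e)⁺)
          (fun i _ => le_inf (posPart_nonneg _) (posPart_nonneg _))
          (Finset.mem_range.2 (Nat.lt_succ_of_le hj)))
    have h2 := two_nsmul_inf_eq_add_sub_abs_sub (j • e - y) (y' - j • e)
    have h3 : y' - j • e - (j • e - y) = y + y' - j • (2 • e) := by
      rw [smul_comm, two_smul]; abel
    have h4 : j • e - y + (y' - j • e) = y' - y := by abel
    rw [h3, h4] at h2
    have h5 := nsmul_le_nsmul_right h1 2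
    rw [h2] at h5
    rw [sub_le_iff_le_add, add_comm]
    exact sub_le_iff_le_add.1 h5
  rw [posPart_of_nonpos, add_zero, sub_le_iff_le_add] at key
  · exact key
  · rw [sub_nonpos, smul_comm, two_smul]
    exact add_le_add hyu hyu'

/-- Quantitative midpoint concavity of `y ↦ y ⊓ a`: the piece `(a - y)⁺ ⊓ (y' - a)⁺` bounds the
concavity defect from below. -/
lemma inf_posPart_add_le (a y y' : E) :
    (a - y)⁺ ⊓ (y' - a)⁺ + y ⊓ a + y' ⊓ a ≤ (y + y') ⊓ (2 • a) := by
  set w := (a - y)⁺ ⊓ (y' - a)⁺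
  have h1 : y ⊓ a = y - (y - a)⁺ := inf_eq_sub_posPart_sub _ _
  have h1' : y ⊓ a = a - (a - y)⁺ := by rw [inf_comm]; exact inf_eq_sub_posPart_sub _ _
  have h2 : y' ⊓ a = y' - (y' - a)⁺ := inf_eq_sub_posPart_sub _ _
  have hw1 : w ≤ (a - y)⁺ := inf_le_left
  have hw2 : w ≤ (y' - a)⁺ := inf_le_right
  refine le_inf ?_ ?_
  · rw [h2]
    calc w + y ⊓ a + (y' - (y' - a)⁺) ≤ (y' - a)⁺ + y + (y' - (y' - a)⁺) := by
          gcongr; exact inf_le_left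
      _ = y + y' := by abel
  · rw [h1', two_smul]
    calc w + (a - (a - y)⁺) + y' ⊓ a ≤ (a - y)⁺ + (a - (a - y)⁺) + a := by
          gcongr; exact inf_le_right
      _ = a + a := by abel

/-- For a monotone sequence `x` this makes the pieces `(a - x n)⁺ ⊓ (x (n + 1) - a)⁺` pairwise
disjoint: the `n`-th one lives where `x n < a < x (n + 1)`. -/
lemma posPart_inf_posPart_sub_eq_zero {a b c : E} (h : b ≤ c) : (a - c)⁺ ⊓ (b - a)⁺ = 0 := by
  refine le_antisymm ?_ (le_inf (posPart_nonneg _) (posPart_nonneg _))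
  rw [← posPart_inf_negPart_eq_zero (a - c)]
  gcongr
  rw [← posPart_neg, neg_sub]
  exact posPart_mono (sub_le_sub_right h a)

lemma sum_range_le_of_disjoint {y : ℕ → E} {u : E} (h0 : ∀ n, 0 ≤ y n) (hu : ∀ n, y n ≤ u)
    (hd : ∀ m n, m ≠ n → y m ⊓ y n = 0) (N : ℕ) : ∑ k ∈ Finset.range N, y k ≤ u := by
  have hu0 : 0 ≤ u := (h0 0).trans (hu 0)
  -- the partial sums stay disjoint from the later terms, so each sum is a supremum
  have key : ∀ n N, N ≤ n → (∑ k ∈ Finset.range N, y k) ⊓ y n = 0 := by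
    intro n N
    induction N with
    | zero => intro _; simpa using h0 n
    | succ N ih =>
      intro hN
      have h1 := ih (by omega)
      have hs : 0 ≤ ∑ k ∈ Finset.range N, y k := Finset.sum_nonneg fun k _ => h0 k
      have h2 := hd N n (by omega)
      rw [Finset.sum_range_succ]
      set s := ∑ k ∈ Finset.range N, y k
      refine le_antisymm ?_ (le_inf (add_nonneg hs (h0 N)) (h0 n))
      set w := (s + y N) ⊓ y n
      have h3 : w - y N ≤ s := by rw [sub_le_iff_le_add]; exact inf_le_left
      have h4 : w - y N ≤ y n := (sub_le_self _ (h0 N)).trans inf_le_right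
      have h5 : w ≤ y N := by
        have := le_inf h3 h4
        rwa [h1, sub_nonpos] at this
      exact (le_inf h5 inf_le_right).trans h2.le
  induction N with
  | zero => simpa using hu0
  | succ N ih =>
    rw [Finset.sum_range_succ, ← inf_add_sup, key N N le_rfl, zero_add]
    exact sup_le ih (hu N)

lemma le_add_sum_of_forall_le_add {x : E} {a b : ℕ → E} (hb : ∀ k, 0 ≤ b k)
    (N : ℕ) (h : ∀ k ≤ N, x ≤ a k + b k) :
    x ≤ (Finset.range (N + 1)).inf' Finset.nonempty_range_add_one a
      + ∑ k ∈ Finset.range (N + 1), b k := by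
  rw [← sub_le_iff_le_add]
  refine Finset.le_inf' _ _ fun k hk => ?_
  rw [sub_le_iff_le_add]
  refine (h k (Nat.lt_succ_iff.1 (Finset.mem_range.1 hk))).trans ?_
  gcongr
  exact Finset.single_le_sum (f := b) (fun i _ => hb i) hk

end LatticeGroup

/-! ### Monotone sequences under a positive operator -/

section NormedLattice

variable {E F : Type*}
    [NormedAddCommGroup E] [Lattice E] [IsOrderedAddMonoid E] [HasSolidNorm E]
    [NormedSpace ℝ E] [IsOrderedModule ℝ E]
    [NormedAddCommGroup F] [Lattice F] [IsOrderedAddMonoid F] [HasSolidNorm F]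
    [NormedSpace ℝ F] [IsOrderedModule ℝ F]

lemma norm_le_norm_of_nonneg_of_le {a b : E} (ha : 0 ≤ a) (hab : a ≤ b) : ‖a‖ ≤ ‖b‖ :=
  norm_le_norm_of_abs_le_abs (by rwa [abs_of_nonneg ha, abs_of_nonneg (ha.trans hab)])

lemma map_le_map_of_nonneg {T : E →ₗ[ℝ] F} (hT : ∀ x, 0 ≤ x → 0 ≤ T x) {x y : E} (h : x ≤ y) :
    T x ≤ T y := by
  have := hT _ (sub_nonneg.2 h)
  rwa [map_sub, sub_nonneg] at this

lemma abs_map_le_map_abs {T : E →ₗ[ℝ] F} (hT : ∀ x, 0 ≤ x → 0 ≤ T x) (x : E) :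
    |T x| ≤ T |x| := by
  rw [abs_le']
  refine ⟨map_le_map_of_nonneg hT (le_abs_self x), ?_⟩
  rw [← map_neg]
  exact map_le_map_of_nonneg hT (neg_le_abs x)

lemma norm_map_le_norm_map {T : E →ₗ[ℝ] F} (hT : ∀ x, 0 ≤ x → 0 ≤ T x) {x y : E} (h0 : 0 ≤ x)
    (h : x ≤ y) : ‖T x‖ ≤ ‖T y‖ :=
  norm_le_norm_of_nonneg_of_le (hT x h0) (map_le_map_of_nonneg hT h)

/-- A positive operator from a Banach lattice to a normed lattice is automatically continuous. -/
theorem continuous_of_map_nonneg [CompleteSpace E] (T : E →ₗ[ℝ] F)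
    (hT : ∀ x, 0 ≤ x → 0 ≤ T x) : Continuous T := by
  obtain ⟨C, hC⟩ : ∃ C : ℝ, ∀ x : E, 0 ≤ x → ‖T x‖ ≤ C * ‖x‖ := by
    by_contra! hcon
    choose x hx0 hx using fun n : ℕ => hcon (4 ^ n)
    have hxpos : ∀ n, 0 < ‖x n‖ := by
      intro n
      rw [norm_pos_iff]
      intro h
      have := hx n
      simp [h] at this
    -- each `z n` is below the sum of the series, while `‖T (z n)‖` is at least `2 ^ n`
    set z : ℕ → E := fun n => ((1 / 2 : ℝ) ^ n * ‖x n‖⁻¹) • x n with hz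
    have hz0 : ∀ n, 0 ≤ z n := fun n => smul_nonneg (by positivity) (hx0 n)
    have hznorm : ∀ n, ‖z n‖ = (1 / 2 : ℝ) ^ n := by
      intro n
      rw [hz]
      simp only [norm_smul, norm_mul, norm_inv, norm_norm, norm_pow]
      rw [mul_assoc, inv_mul_cancel₀ (hxpos n).ne', mul_one]
      norm_num
    have hsum : Summable z := by
      refine Summable.of_norm ?_
      simp_rw [hznorm]
      exact summable_geometric_of_lt_one (by norm_num) (by norm_num)
    have hle : ∀ n, (2 : ℝ) ^ n ≤ ‖T (∑' n, z n)‖ := by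
      intro n
      refine le_trans ?_ (norm_map_le_norm_map hT (hz0 n) (hsum.le_tsum n fun j _ => hz0 j))
      rw [hz]
      simp only [map_smul, norm_smul, norm_mul, norm_inv, norm_norm, norm_pow]
      have h1 : (4 : ℝ) ^ n ≤ ‖x n‖⁻¹ * ‖T (x n)‖ := by
        rw [inv_mul_eq_div, le_div_iff₀ (hxpos n)]
        exact (hx n).le
      have h2 : ‖(1 / 2 : ℝ)‖ ^ n * 4 ^ n = 2 ^ n := by
        rw [← mul_pow]; norm_num
      rw [mul_assoc, ← h2]
      gcongr
    obtain ⟨n, hn⟩ := pow_unbounded_of_one_lt ‖T (∑' n, z n)‖ (by norm_num : (1 : ℝ) < 2)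
    exact absurd (hle n) (not_le.2 hn)
  refine (T.mkContinuous C fun x => ?_).continuous
  have h1 : ‖T x‖ ≤ ‖T |x|‖ := by
    refine norm_le_norm_of_abs_le_abs ((abs_map_le_map_abs hT x).trans (le_abs_self _))
  exact h1.trans ((hC _ (abs_nonneg x)).trans (by rw [norm_abs_eq_norm]))

/-- The increments of a monotone sequence in `[0, u]` are, up to a small multiple of `u`, finite
sums of terms of disjoint sequences in `[0, u]`, so their images tend to zero as soon as the images
of disjoint sequences do. -/
lemma tendsto_map_sub_of_monotone {T : E →ₗ[ℝ] F} (hT : ∀ x, 0 ≤ x → 0 ≤ T x) {u : E}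
    (hdis : ∀ y : ℕ → E, (∀ n, 0 ≤ y n) → (∀ n, y n ≤ u) → (∀ m n, m ≠ n → y m ⊓ y n = 0) →
      Tendsto (fun n => T (y n)) atTop (𝓝 0))
    {x : ℕ → E} (hx : Monotone x) (h0 : ∀ n, 0 ≤ x n) (hu : ∀ n, x n ≤ u) :
    Tendsto (fun n => T (x (n + 1) - x n)) atTop (𝓝 0) := by
  have hu0 : 0 ≤ u := (h0 0).trans (hu 0)
  rw [Metric.tendsto_atTop]
  intro ε hε
  obtain ⟨N, hN⟩ : ∃ N : ℕ, 2 * (((N : ℝ) + 1)⁻¹ * ‖T u‖) < ε / 2 := by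
    have h : Tendsto (fun N : ℕ => 2 * (((N : ℝ) + 1)⁻¹ * ‖T u‖)) atTop (𝓝 (2 * (0 * ‖T u‖))) := by
      refine Tendsto.const_mul _ (Tendsto.mul_const _ ?_)
      simpa [one_div] using tendsto_one_div_add_atTop_nhds_zero_nat (𝕜 := ℝ)
    rw [zero_mul, mul_zero] at h
    exact (h.eventually (gt_mem_nhds (half_pos hε))).exists
  set e : E := ((N : ℝ) + 1)⁻¹ • u with he
  have he0 : 0 ≤ e := smul_nonneg (by positivity) hu0
  have heN : (N + 1) • e = u := by
    rw [he, ← Nat.cast_smul_eq_nsmul ℝ, smul_smul, Nat.cast_succ,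
      mul_inv_cancel₀ (by positivity), one_smul]
  set z : ℕ → ℕ → E := fun j n => (j • e - x n)⁺ ⊓ (x (n + 1) - j • e)⁺ with hz
  have hz0 : ∀ j n, 0 ≤ z j n := fun j n => le_inf (posPart_nonneg _) (posPart_nonneg _)
  have hzdis : ∀ j m n, m < n → z j m ⊓ z j n = 0 := by
    intro j m n hmn
    refine le_antisymm ?_ (le_inf (hz0 j m) (hz0 j n))
    rw [← posPart_inf_posPart_sub_eq_zero (a := j • e) (hx (Nat.succ_le_of_lt hmn)), inf_comm]
    exact inf_le_inf inf_le_left inf_le_right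
  have hzt : ∀ j, Tendsto (fun n => T (z j n)) atTop (𝓝 0) := by
    intro j
    refine hdis (z j) (hz0 j) (fun n => ?_) fun m n hmn => ?_
    · refine inf_le_right.trans ((posPart_mono (a := x (n + 1) - j • e) (b := u) ?_).trans ?_)
      · exact (sub_le_self _ (nsmul_nonneg he0 j)).trans (hu _)
      · simp [posPart_of_nonneg hu0]
    · rcases lt_or_gt_of_ne hmn with h | h
      · exact hzdis j m n h
      · rw [inf_comm]; exact hzdis j n m h
  have hs : Tendsto (fun n => 2 * ‖∑ j ∈ Finset.range (N + 1 + 1), T (z j n)‖) atTop (𝓝 0) := by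
    have := (tendsto_finsetSum (Finset.range (N + 1 + 1)) fun j _ => hzt j).norm.const_mul 2
    simpa using this
  obtain ⟨n₀, hn₀⟩ := Filter.eventually_atTop.1 (hs.eventually (gt_mem_nhds (half_pos hε)))
  refine ⟨n₀, fun n hn => ?_⟩
  rw [dist_zero_right]
  have hbd : x (n + 1) - x n ≤ 2 • e + 2 • ∑ j ∈ Finset.range (N + 1 + 1), z j n :=
    sub_le_two_nsmul_add_sum_inf he0 (N + 1) (h0 n) (h0 (n + 1)) (heN ▸ hu n) (heN ▸ hu _)
  have hle := norm_map_le_norm_map hT (sub_nonneg.2 (hx n.le_succ)) hbd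
  have h1 := hn₀ n hn
  have hTe : ‖T e‖ = ((N : ℝ) + 1)⁻¹ * ‖T u‖ := by
    rw [he, map_smul, norm_smul, Real.norm_of_nonneg (by positivity)]
  rw [map_add, map_nsmul, map_nsmul, map_sum, two_smul, two_smul] at hle
  have h2 := norm_add_le (T e + T e) (∑ j ∈ Finset.range (N + 1 + 1), T (z j n) +
    ∑ j ∈ Finset.range (N + 1 + 1), T (z j n))
  have h3 := norm_add_le (T e) (T e)
  have h4 := norm_add_le (∑ j ∈ Finset.range (N + 1 + 1), T (z j n))
    (∑ j ∈ Finset.range (N + 1 + 1), T (z j n))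
  rw [← hTe] at hN
  linarith

theorem cauchySeq_map_of_monotone {T : E →ₗ[ℝ] F} (hT : ∀ x, 0 ≤ x → 0 ≤ T x) {u : E}
    (hdis : ∀ y : ℕ → E, (∀ n, 0 ≤ y n) → (∀ n, y n ≤ u) → (∀ m n, m ≠ n → y m ⊓ y n = 0) →
      Tendsto (fun n => T (y n)) atTop (𝓝 0))
    {x : ℕ → E} (hx : Monotone x) (h0 : ∀ n, 0 ≤ x n) (hu : ∀ n, x n ≤ u) :
    CauchySeq fun n => T (x n) := by
  rw [Metric.cauchySeq_iff']
  by_contra! hcon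
  obtain ⟨ε, hε, hcon⟩ := hcon
  -- iterating `φ` yields a subsequence whose increments have images of norm at least `ε`
  choose φ hφ1 hφ2 using hcon
  set ψ : ℕ → ℕ := fun k => φ^[k] 0
  have hψ : ∀ k, ψ (k + 1) = φ (ψ k) := fun k => Function.iterate_succ_apply' φ k 0
  have hψm : Monotone ψ := monotone_nat_of_le_succ fun k => by rw [hψ]; exact hφ1 _
  have ht := tendsto_map_sub_of_monotone hT hdis (hx.comp hψm) (fun n => h0 _) fun n => hu _
  obtain ⟨k, hk⟩ := ((tendsto_zero_iff_norm_tendsto_zero.1 ht).eventually (gt_mem_nhds hε)).exists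
  have h2 := hφ2 (ψ k)
  rw [← hψ, dist_eq_norm, ← map_sub] at h2
  exact absurd h2 (not_le.2 hk)

end NormedLattice

/-! ### Positive functionals -/

section Functionals

variable {E F : Type*}
    [NormedAddCommGroup E] [Lattice E] [IsOrderedAddMonoid E] [HasSolidNorm E]
    [NormedSpace ℝ E] [IsOrderedModule ℝ E]
    [NormedAddCommGroup F] [Lattice F] [IsOrderedAddMonoid F] [HasSolidNorm F]
    [NormedSpace ℝ F] [IsOrderedModule ℝ F]

lemma posPart_smul_of_nonneg {c : ℝ} (hc : 0 ≤ c) (x : F) : (c • x)⁺ = c • x⁺ := by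
  rcases hc.eq_or_lt with rfl | hc
  · simp
  · refine le_antisymm ?_ ?_
    · exact sup_le (smul_le_smul_of_nonneg_left (le_posPart x) hc.le)
        (smul_nonneg hc.le (posPart_nonneg x))
    · rw [← le_inv_smul_iff_of_pos hc]
      refine sup_le ?_ (smul_nonneg (inv_nonneg.2 hc.le) (posPart_nonneg _))
      rw [le_inv_smul_iff_of_pos hc]
      exact le_posPart _

lemma posPart_add_le (x y : F) : (x + y)⁺ ≤ x⁺ + y⁺ :=
  sup_le (add_le_add (le_posPart x) (le_posPart y))
    (add_nonneg (posPart_nonneg x) (posPart_nonneg y))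

/-- A bounded functional on a normed lattice is dominated by a positive one, with control of the
norm. Instead of constructing the modulus of `f`, one extends `(x, -x) ↦ f x` from the
antidiagonal of `F × F` under the sublinear map `(a, b) ↦ ‖f‖ * ‖a⁺ + b⁺‖`: an extension
`(a, b) ↦ G₁ a + G₂ b` below this map has positive components, and `f = G₁ - G₂`. -/
theorem exists_nonneg_dominating_functional (f : StrongDual ℝ F) :
    ∃ G : F →ₗ[ℝ] ℝ, (∀ x, 0 ≤ x → 0 ≤ G x) ∧ (∀ x, |f x| ≤ G |x|) ∧
      ∀ x, 0 ≤ x → G x ≤ 2 * ‖f‖ * ‖x‖ := by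
  -- the antidiagonal `{(x, -x)}`
  let D : Submodule ℝ (F × F) := LinearMap.ker (LinearMap.coprod LinearMap.id LinearMap.id)
  let f₀ : (F × F) →ₗ.[ℝ] ℝ := ⟨D, f.toLinearMap ∘ₗ LinearMap.fst ℝ F F ∘ₗ D.subtype⟩
  let p : F × F → ℝ := fun q => ‖f‖ * ‖q.1⁺ + q.2⁺‖
  have hp₁ : ∀ c : ℝ, 0 < c → ∀ q, p (c • q) = c * p q := by
    intro c hc q
    simp only [p, Prod.smul_fst, Prod.smul_snd, posPart_smul_of_nonneg hc.le, ← smul_add,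
      norm_smul, Real.norm_of_nonneg hc.le]
    ring
  have hp₂ : ∀ q q', p (q + q') ≤ p q + p q' := by
    intro q q'
    simp only [p]
    rw [← mul_add]
    refine mul_le_mul_of_nonneg_left (le_trans ?_ (norm_add_le _ _)) (norm_nonneg f)
    refine norm_le_norm_of_nonneg_of_le (add_nonneg (posPart_nonneg _) (posPart_nonneg _)) ?_
    rw [add_add_add_comm]
    exact add_le_add (posPart_add_le _ _) (posPart_add_le _ _)
  have hp₃ : ∀ q : f₀.domain, f₀ q ≤ p q := by
    rintro ⟨⟨a, b⟩, hab⟩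
    have hb : b = -a := by
      have : a + b = 0 := by simpa [D, f₀] using hab
      exact (neg_eq_of_add_eq_zero_right this).symm
    subst hb
    change f a ≤ ‖f‖ * ‖a⁺ + (-a)⁺‖
    rw [posPart_neg, posPart_add_negPart, norm_abs_eq_norm]
    exact (le_abs_self _).trans (f.le_opNorm a)
  obtain ⟨g, hg₁, hg₂⟩ := exists_extension_of_le_sublinear f₀ p hp₁ hp₂ hp₃
  have hpos : ∀ a b : F, 0 ≤ a → 0 ≤ b → 0 ≤ g (a, b) := by
    intro a b ha hb
    have h := hg₂ (-(a, b))
    simp only [p, map_neg, Prod.fst_neg, Prod.snd_neg, posPart_neg, negPart_of_nonneg ha,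
      negPart_of_nonneg hb, add_zero, norm_zero, mul_zero] at h
    linarith
  have hsplit : ∀ x : F, f x = g (x, 0) - g (0, x) := by
    intro x
    have h : g (x, -x) = f x := hg₁ ⟨(x, -x), by simp [f₀, D]⟩
    rw [← h, ← map_sub]
    simp
  let G₁ : F →ₗ[ℝ] ℝ := g ∘ₗ LinearMap.inl ℝ F F
  let G₂ : F →ₗ[ℝ] ℝ := g ∘ₗ LinearMap.inr ℝ F F
  have h₁ : ∀ x, 0 ≤ x → 0 ≤ G₁ x := fun x hx => hpos x 0 hx le_rfl
  have h₂ : ∀ x, 0 ≤ x → 0 ≤ G₂ x := fun x hx => hpos 0 x le_rfl hx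
  refine ⟨G₁ + G₂, fun x hx => add_nonneg (h₁ x hx) (h₂ x hx), fun x => ?_, fun x hx => ?_⟩
  · rw [hsplit]
    exact (abs_sub _ _).trans (add_le_add (abs_map_le_map_abs h₁ x) (abs_map_le_map_abs h₂ x))
  · have e₁ := hg₂ (x, 0)
    have e₂ := hg₂ (0, x)
    simp only [p, posPart_of_nonneg hx, posPart_zero, add_zero, zero_add] at e₁ e₂
    change g (x, 0) + g (0, x) ≤ _
    linarith

/-- A uniform absolute continuity principle. If `T` maps monotone sequences of `[0, u]` to Cauchy
sequences, then on `[0, u]` smallness of finitely many of the positive functionals `G i ∘ T` forces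
smallness of all of them simultaneously. Otherwise there are `w k ∈ [0, u]` with
`G j (T (w k)) ≤ 2⁻ᵏ` for `j ≤ k` and some `G i (T (w k)) > ε`. The elements `r N`, which
approximate `⨆ k ≥ N, w k` and decrease, have images converging in norm to some `v` with
`G i v ≤ 0` for all `i`; as the `G i` are equicontinuous, this is incompatible with the lower bound `ε`. -/
theorem exists_uniform_bound_of_finite_bound [CompleteSpace F] {T : E →ₗ[ℝ] F}
    (hT : ∀ x, 0 ≤ x → 0 ≤ T x) {u : E}
    (hmono : ∀ x : ℕ → E, Monotone x → (∀ n, 0 ≤ x n) → (∀ n, x n ≤ u) →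
      CauchySeq fun n => T (x n))
    {G : ℕ → F →ₗ[ℝ] ℝ} (hG : ∀ i x, 0 ≤ x → 0 ≤ G i x) {C : ℝ} (hC : 0 < C)
    (hGC : ∀ i x, 0 ≤ x → G i x ≤ C * ‖x‖) {ε : ℝ} (hε : 0 < ε) :
    ∃ η > 0, ∃ I : ℕ, ∀ w, 0 ≤ w → w ≤ u → (∀ j ≤ I, G j (T w) ≤ η) → ∀ i, G i (T w) ≤ ε := by
  by_contra! hcon
  choose w hw0 hwu hw i hi using fun k : ℕ => hcon ((1 / 2) ^ k) (by positivity) k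
  have hGC' : ∀ i x, G i x ≤ C * ‖x‖ := fun i x =>
    (map_le_map_of_nonneg (hG i) (le_abs_self x)).trans
      ((hGC i _ (abs_nonneg x)).trans (by rw [norm_abs_eq_norm]))
  -- `s n m` is the supremum of `w n, …, w (n + m)`
  set s : ℕ → ℕ → E := fun n m => partialSups (fun k => w (n + k)) m with hs
  have hsmono : ∀ n, Monotone (s n) := fun n => (partialSups fun k => w (n + k)).monotone
  have hws : ∀ n k, w (n + k) ≤ s n k := fun n k => le_partialSups (fun k => w (n + k)) k
  have hs0 : ∀ n m, 0 ≤ s n m := fun n m => (hw0 (n + m)).trans (hws n m)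
  have hsu : ∀ n m, s n m ≤ u := fun n m => partialSups_le _ _ _ fun k _ => hwu _
  have hGs : ∀ i n m, i ≤ n → G i (T (s n m)) ≤ 2 * (1 / 2) ^ n := by
    intro i n m hin
    have h1 : s n m ≤ ∑ k ∈ Finset.range (m + 1), w (n + k) :=
      partialSups_le _ _ _ fun k hk =>
        Finset.single_le_sum (f := fun k => w (n + k)) (fun j _ => hw0 _)
          (Finset.mem_range.2 (Nat.lt_succ_of_le hk))
    have h2 := map_le_map_of_nonneg (hG i) (map_le_map_of_nonneg hT h1)
    rw [map_sum, map_sum] at h2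
    refine h2.trans ?_
    calc ∑ k ∈ Finset.range (m + 1), G i (T (w (n + k)))
        ≤ ∑ k ∈ Finset.range (m + 1), (1 / 2 : ℝ) ^ n * (1 / 2) ^ k :=
          Finset.sum_le_sum fun k _ => by
            rw [← pow_add]; exact hw (n + k) i (hin.trans (Nat.le_add_right n k))
      _ = (1 / 2 : ℝ) ^ n * ∑ k ∈ Finset.range (m + 1), (1 / 2 : ℝ) ^ k := by
          rw [Finset.mul_sum]
      _ ≤ (1 / 2 : ℝ) ^ n * 2 := by gcongr; exact sum_geometric_two_le _
      _ = 2 * (1 / 2) ^ n := mul_comm _ _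
  set δ : ℝ := ε / (4 * C) with hδ
  have hδ0 : 0 < δ := by positivity
  have hm : ∀ n, ∃ m, ∀ M ≥ m, ‖T (s n M) - T (s n m)‖ < δ * (1 / 2) ^ n := by
    intro n
    obtain ⟨m, hm⟩ := Metric.cauchySeq_iff'.1 (hmono (s n) (hsmono n) (hs0 n) (hsu n))
      (δ * (1 / 2) ^ n) (by positivity)
    exact ⟨m, fun M hM => by rw [← dist_eq_norm]; exact hm M hM⟩
  choose m hm using hm
  -- taking the infimum over `k ≤ N` makes the approximate suprema `s k (m k)` decrease in `N`
  set r : ℕ → E := fun N =>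
    (Finset.range (N + 1)).inf' Finset.nonempty_range_add_one fun k => s k (m k) with hr
  have hranti : Antitone r := fun N N' h =>
    Finset.inf'_mono _ (Finset.range_mono (Nat.succ_le_succ h)) _
  have hr0 : ∀ N, 0 ≤ r N := fun N => Finset.le_inf' _ _ fun k _ => hs0 k _
  have hrs : ∀ N, r N ≤ s N (m N) := fun N => Finset.inf'_le _ (Finset.self_mem_range_succ N)
  obtain ⟨v, hv⟩ : ∃ v, Tendsto (fun N => T (r N)) atTop (𝓝 v) := by
    have h := hmono (fun N => u - r N) (fun a b hab => sub_le_sub_left (hranti hab) u)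
      (fun N => sub_nonneg.2 ((hrs N).trans (hsu _ _))) (fun N => sub_le_self _ (hr0 N))
    obtain ⟨v', hv'⟩ := cauchySeq_tendsto_of_complete h
    refine ⟨T u - v', ?_⟩
    simpa using hv'.const_sub (T u)
  have hGv : ∀ i, G i v ≤ 0 := by
    intro i
    have h1 := ((continuous_of_map_nonneg (G i) (hG i)).tendsto v).comp hv
    have h2 : Tendsto (fun N : ℕ => 2 * (1 / 2 : ℝ) ^ N) atTop (𝓝 0) := by
      simpa using (tendsto_pow_atTop_nhds_zero_of_lt_one (r := (1 / 2 : ℝ)) (by norm_num)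
        (by norm_num)).const_mul 2
    refine le_of_tendsto_of_tendsto h1 h2 ?_
    filter_upwards [eventually_ge_atTop i] with N hN
    exact (map_le_map_of_nonneg (hG i) (map_le_map_of_nonneg hT (hrs N))).trans (hGs i N _ hN)
  obtain ⟨N, hN⟩ := (Metric.tendsto_nhds.1 hv (ε / (2 * C)) (by positivity)).exists
  rw [dist_eq_norm, lt_div_iff₀ (by positivity)] at hN
  -- `w N` lies below every `s k (N + m k)` with `k ≤ N`, which is `T`-close to `s k (m k)`
  set b : ℕ → E := fun k => s k (N + m k) - s k (m k) with hb
  have hwN : w N ≤ r N + ∑ k ∈ Finset.range (N + 1), b k := by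
    refine le_add_sum_of_forall_le_add
      (fun k => sub_nonneg.2 (hsmono k (Nat.le_add_left _ _))) N fun k hk => ?_
    rw [add_sub_cancel]
    obtain ⟨l, rfl⟩ := Nat.exists_eq_add_of_le hk
    exact (hws k l).trans (hsmono k (by omega))
  have hb' : ‖∑ k ∈ Finset.range (N + 1), T (b k)‖ ≤ δ * 2 := by
    calc ‖∑ k ∈ Finset.range (N + 1), T (b k)‖
        ≤ ∑ k ∈ Finset.range (N + 1), δ * (1 / 2) ^ k :=
          norm_sum_le_of_le _ fun k _ => by
            rw [hb, map_sub]; exact (hm k _ (Nat.le_add_left _ _)).le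
      _ = δ * ∑ k ∈ Finset.range (N + 1), (1 / 2 : ℝ) ^ k := by rw [Finset.mul_sum]
      _ ≤ δ * 2 := by gcongr; exact sum_geometric_two_le _
  have h1 := map_le_map_of_nonneg (hG (i N)) (map_le_map_of_nonneg hT hwN)
  rw [map_add, map_add, map_sum] at h1
  have h2 := hGC' (i N) (T (r N) - v)
  rw [map_sub] at h2
  have h3 := (hGC' (i N) (∑ k ∈ Finset.range (N + 1), T (b k))).trans
    (mul_le_mul_of_nonneg_left hb' hC.le)
  have h4 : C * (δ * 2) = ε / 2 := by rw [hδ]; field_simp; norm_num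
  have h5 := hGv (i N)
  have h6 := hi N
  linarith

end Functionals

/-! ### Failure of weak compactness -/

section WeakCompactness

variable {F : Type*} [NormedAddCommGroup F] [NormedSpace ℝ F]

/-- A form of Helly's theorem: an element `φ` of the bidual at distance more than `δ` from the space
is still larger than `δ` at some functional of the dual ball annihilating any prescribed finite
set. -/
theorem exists_functional_vanishing_on_finset {φ : StrongDual ℝ (StrongDual ℝ F)} {δ : ℝ}
    (hδ : 0 ≤ δ) (hφ : ∀ x : F, δ < ‖φ - NormedSpace.inclusionInDoubleDual ℝ F x‖)
    (s : Finset F) :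
    ∃ f : StrongDual ℝ F, ‖f‖ ≤ 1 ∧ (∀ x ∈ s, f x = 0) ∧ δ < φ f := by
  by_contra! hcon
  set J := NormedSpace.inclusionInDoubleDual ℝ F with hJ
  let L : s → StrongDual ℝ F →ₗ[ℝ] ℝ := fun x => (J x : StrongDual ℝ F →ₗ[ℝ] ℝ)
  -- the annihilator of `s`; restricted to it, `φ` has norm at most `δ` by assumption
  let p : Submodule ℝ (StrongDual ℝ F) := ⨅ x : s, LinearMap.ker (L x)
  have hp : ∀ f : StrongDual ℝ F, f ∈ p → ∀ x ∈ s, f x = 0 := by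
    intro f hf x hx
    exact (Submodule.mem_iInf _).1 hf ⟨x, hx⟩
  obtain ⟨ψ, hψ₁, hψ₂⟩ := _root_.exists_extension_norm_eq p (φ.comp p.subtypeL)
  have hψδ : ‖ψ‖ ≤ δ := by
    rw [hψ₂]
    refine ContinuousLinearMap.opNorm_le_of_unit_norm hδ fun f hf => ?_
    have hf1 : ‖(f : StrongDual ℝ F)‖ = 1 := hf
    have h1 := hcon f hf1.le (hp f f.2)
    have h2 := hcon (-f) (by rw [norm_neg]; exact hf1.le)
      fun x hx => by simp [hp f f.2 x hx]
    rw [map_neg] at h2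
    rw [Real.norm_eq_abs, abs_le]
    exact ⟨by simpa using neg_le.1 h2, h1⟩
  -- `φ - ψ` vanishes on the annihilator of `s`, so it comes from the span of `s`
  have hmem : ((φ - ψ : StrongDual ℝ (StrongDual ℝ F)) : StrongDual ℝ F →ₗ[ℝ] ℝ) ∈
      Submodule.span ℝ (Set.range L) := by
    refine mem_span_of_iInf_ker_le_ker fun f hf => ?_
    have := hψ₁ ⟨f, hf⟩
    simp only [ContinuousLinearMap.comp_apply, Submodule.subtypeL_apply] at this
    simp [this]
  obtain ⟨x, hx⟩ : ∃ x : F, J x = φ - ψ := by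
    have hle : Submodule.span ℝ (Set.range L) ≤
        LinearMap.range ((ContinuousLinearMap.coeLM ℝ).comp J.toLinearMap) := by
      rw [Submodule.span_le]
      rintro _ ⟨x, rfl⟩
      exact ⟨x, rfl⟩
    obtain ⟨x, hx⟩ := hle hmem
    exact ⟨x, ContinuousLinearMap.coe_injective hx⟩
  have := hφ x
  have heq : φ - J x = ψ := by rw [hx]; exact sub_sub_cancel φ ψ
  rw [heq] at this
  exact absurd this (not_lt.2 hψδ)

/-- If a bounded set is not relatively weakly compact, then, along points of the set and functionals
in the dual ball, the values `f i (x n)` stay away from zero for `i ≤ n` and vanish for `n < i`.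
Both sequences are built from a weak-star closure point of the set in the bidual that does not come
from the space. -/
theorem exists_triangular_seq_of_not_isRelativelyWeaklyCompact [CompleteSpace F] {B : Set F}
    (hB : Bornology.IsBounded B) (h : ¬ IsRelativelyWeaklyCompact B) :
    ∃ δ > 0, ∃ (x : ℕ → F) (f : ℕ → StrongDual ℝ F), (∀ n, x n ∈ B) ∧ (∀ n, ‖f n‖ ≤ 1) ∧
      (∀ i n, i ≤ n → δ < f i (x n)) ∧ ∀ i n, n < i → f i (x n) = 0 := by
  classical
  obtain ⟨φ, hφcl, hφ⟩ : ∃ φ ∈ closure (NormedSpace.inclusionInDoubleDualWeak ℝ F ''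
      (toWeakSpace ℝ F '' B)), φ ∉ Set.range (NormedSpace.inclusionInDoubleDualWeak ℝ F) := by
    by_contra! hcon
    refine h (NormedSpace.isCompact_closure_of_isBounded ℝ F _ ?_ hcon)
    rwa [Set.preimage_image_eq _ (toWeakSpace ℝ F).injective]
  set φ' : StrongDual ℝ (StrongDual ℝ F) := WeakDual.toStrongDual φ with hφ'
  obtain ⟨δ, hδ, hdist⟩ : ∃ δ > 0, ∀ x : F,
      δ < ‖φ' - NormedSpace.inclusionInDoubleDual ℝ F x‖ := by
    have hcl : IsClosed (Set.range (NormedSpace.inclusionInDoubleDualLi (E := F) ℝ)) :=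
      ((NormedSpace.inclusionInDoubleDualLi (E := F) ℝ).isometry.isUniformInducing.isComplete_range
        ).isClosed
    have hmem : φ' ∉ Set.range (NormedSpace.inclusionInDoubleDualLi (E := F) ℝ) := by
      rintro ⟨x, hx⟩
      refine hφ ⟨toWeakSpace ℝ F x, ?_⟩
      apply WeakDual.toStrongDual.injective
      exact hx
    have hpos := (hcl.notMem_iff_infDist_pos (Set.range_nonempty _)).1 hmem
    refine ⟨_, half_pos hpos, fun x => (half_lt_self hpos).trans_le ?_⟩
    have heq : ‖φ' - NormedSpace.inclusionInDoubleDual ℝ F x‖ =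
        dist φ' (NormedSpace.inclusionInDoubleDualLi ℝ x) :=
      (dist_eq_norm (E := StrongDual ℝ (StrongDual ℝ F)) φ'
        (NormedSpace.inclusionInDoubleDual ℝ F x)).symm
    rw [heq]
    exact Metric.infDist_le_dist_of_mem (Set.mem_range_self x)
  have happrox : ∀ t : Finset (StrongDual ℝ F), (∀ f ∈ t, δ < φ' f) →
      ∃ x ∈ B, ∀ f ∈ t, δ < f x := by
    intro t ht
    have hopen : IsOpen (⋂ f ∈ t, {ψ : WeakDual ℝ (StrongDual ℝ F) | δ < ψ f}) :=
      isOpen_biInter_finset fun f _ => isOpen_lt continuous_const (WeakDual.eval_continuous f)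
    obtain ⟨_, hψ, _, ⟨x, hx, rfl⟩, rfl⟩ := mem_closure_iff.1 hφcl _ hopen
      (Set.mem_iInter₂.2 fun f hf => ht f hf)
    exact ⟨x, hx, fun f hf => Set.mem_iInter₂.1 hψ f hf⟩
  -- each new functional annihilates all earlier points, and each new point is large at all
  -- functionals chosen so far, the newest one included
  obtain ⟨q, hq₁, hq₂⟩ := exists_seq_of_forall_finset_exists
    (fun q : F × StrongDual ℝ F => q.1 ∈ B ∧ ‖q.2‖ ≤ 1 ∧ δ < q.2 q.1 ∧ δ < φ' q.2)
    (fun q q' => q'.2 q.1 = 0 ∧ δ < q.2 q'.1) (fun s hs => by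
      obtain ⟨f, hf₁, hf₂, hf₃⟩ :=
        exists_functional_vanishing_on_finset hδ.le hdist (s.image Prod.fst)
      obtain ⟨x, hx, hxf⟩ := happrox (insert f (s.image Prod.snd)) (by
        intro g hg
        rcases Finset.mem_insert.1 hg with rfl | hg
        · exact hf₃
        · obtain ⟨q, hq, rfl⟩ := Finset.mem_image.1 hg
          exact (hs q hq).2.2.2)
      refine ⟨(x, f), ⟨hx, hf₁, hxf f (Finset.mem_insert_self _ _), hf₃⟩, fun q hq => ⟨?_, ?_⟩⟩
      · exact hf₂ _ (Finset.mem_image_of_mem _ hq)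
      · exact hxf _ (Finset.mem_insert_of_mem (Finset.mem_image_of_mem _ hq)))
  refine ⟨δ, hδ, fun n => (q n).1, fun n => (q n).2, fun n => (hq₁ n).1, fun n => (hq₁ n).2.1,
    fun i n hin => ?_, fun i n hni => (hq₂ n i hni).1⟩
  rcases hin.eq_or_lt with rfl | hin
  · exact (hq₁ i).2.2.1
  · exact (hq₂ i n hin).2

end WeakCompactness

/-! ### Weak compactness and monotone sequences -/

section MonotoneWeak

variable {F : Type*} [NormedAddCommGroup F] [Lattice F] [IsOrderedAddMonoid F] [HasSolidNorm F]
    [NormedSpace ℝ F] [IsOrderedModule ℝ F]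

/-- A Dini-type statement: a weak cluster point of a monotone sequence is its norm limit. It lies in
the weak closure, hence by convexity in the norm closure, of the set of elements below some term. -/
theorem exists_tendsto_of_monotone_of_isRelativelyWeaklyCompact {B : Set F}
    (hB : IsRelativelyWeaklyCompact B) {z : ℕ → F} (hz : Monotone z) (hzB : ∀ n, z n ∈ B) :
    ∃ a, Tendsto z atTop (𝓝 a) := by
  obtain ⟨p, -, hp⟩ := hB.exists_mapClusterPt (f := atTop) (u := fun n => toWeakSpace ℝ F (z n))
    (le_principal_iff.2 <| mem_map.2 <| Eventually.of_forall fun n =>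
      subset_closure (Set.mem_image_of_mem _ (hzB n)))
  obtain ⟨a, rfl⟩ := (toWeakSpace ℝ F).surjective p
  have hmem : ∀ s : Set F, Convex ℝ s → (∀ᶠ n in atTop, z n ∈ s) → a ∈ closure s := by
    intro s hs hev
    have h1 : toWeakSpace ℝ F a ∈ closure (toWeakSpace ℝ F '' s) :=
      mem_closure_iff_clusterPt.2 (ClusterPt.mono hp (le_principal_iff.2 <| mem_map.2 <|
        hev.mono fun n hn => Set.mem_image_of_mem _ hn))
    rw [← hs.toWeakSpace_closure ℝ] at h1
    obtain ⟨b, hb, hab⟩ := h1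
    rwa [← (toWeakSpace ℝ F).injective hab]
  have hle : ∀ n, z n ≤ a := by
    intro n
    have := hmem (Set.Ici (z n)) (convex_Ici _) (by
      filter_upwards [eventually_ge_atTop n] with k hk using hz hk)
    rwa [isClosed_Ici.closure_eq] at this
  have hD : a ∈ closure {c : F | ∃ n, c ≤ z n} := by
    refine hmem _ ?_ (Eventually.of_forall fun n => ⟨n, le_rfl⟩)
    rintro c ⟨n, hn⟩ c' ⟨n', hn'⟩ α β hα hβ hαβ
    refine ⟨max n n', ?_⟩
    calc α • c + β • c' ≤ α • z (max n n') + β • z (max n n') :=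
          add_le_add (smul_le_smul_of_nonneg_left (hn.trans (hz (le_max_left _ _))) hα)
            (smul_le_smul_of_nonneg_left (hn'.trans (hz (le_max_right _ _))) hβ)
      _ = z (max n n') := by rw [← add_smul, hαβ, one_smul]
  refine ⟨a, Metric.tendsto_atTop.2 fun ε hε => ?_⟩
  obtain ⟨c, ⟨N, hN⟩, hc⟩ := Metric.mem_closure_iff.1 hD ε hε
  refine ⟨N, fun n hn => ?_⟩
  rw [dist_comm, dist_eq_norm]
  rw [dist_eq_norm] at hc
  exact (norm_le_norm_of_nonneg_of_le (sub_nonneg.2 (hle n))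
    (sub_le_sub_left (hN.trans (hz hn)) a)).trans_lt hc

end MonotoneWeak

/-! ### Almost order bounded sets -/

section AlmostOrderBounded

variable {E F : Type*}
    [NormedAddCommGroup E] [Lattice E] [IsOrderedAddMonoid E] [HasSolidNorm E]
    [NormedSpace ℝ E] [IsOrderedModule ℝ E]
    [NormedAddCommGroup F] [Lattice F] [IsOrderedAddMonoid F] [HasSolidNorm F]
    [NormedSpace ℝ F] [IsOrderedModule ℝ F]

lemma IsAlmostOrderBounded.of_subset_Icc {A : Set E} {u : E} (hu : 0 ≤ u)
    (hA : A ⊆ Set.Icc (-u) u) : IsAlmostOrderBounded A := fun ε hε =>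
  ⟨u, hu, fun x hx => ⟨x, hA hx, 0, ⟨0, by simp, by simp⟩, by simp⟩⟩

/-- The definition with the scaled unit ball unfolded. -/
lemma IsAlmostOrderBounded.exists_forall_add {A : Set E} (hA : IsAlmostOrderBounded A) {ε : ℝ}
    (hε : 0 < ε) :
    ∃ u : E, 0 ≤ u ∧ ∀ x ∈ A, ∃ c b : E, -u ≤ c ∧ c ≤ u ∧ ‖b‖ ≤ ε ∧ x = c + b := by
  obtain ⟨u, hu, hAu⟩ := hA ε hε
  refine ⟨u, hu, fun x hx => ?_⟩
  obtain ⟨c, hc, _, ⟨b, hb, rfl⟩, rfl⟩ := hAu hx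
  refine ⟨c, ε • b, hc.1, hc.2, ?_, rfl⟩
  rw [norm_smul, Real.norm_of_nonneg hε.le]
  exact mul_le_of_le_one_right hε.le (by simpa using hb)

lemma IsAlmostOrderBounded.isBounded {A : Set E} (hA : IsAlmostOrderBounded A) :
    Bornology.IsBounded A := by
  obtain ⟨u, hu, h⟩ := hA.exists_forall_add one_pos
  refine isBounded_iff_forall_norm_le.2 ⟨‖u‖ + 1, fun x hx => ?_⟩
  obtain ⟨c, b, hc₁, hc₂, hb, rfl⟩ := h x hx
  refine (norm_add_le _ _).trans (add_le_add (norm_le_norm_of_abs_le_abs ?_) hb)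
  rw [abs_of_nonneg hu]
  exact abs_le'.2 ⟨hc₂, neg_le.1 hc₁⟩

/-- A substitute for uniform convexity. For a decreasing sequence of nonempty midpoint-convex
subsets of `[0, u]` and a positive functional `g`, near-maximisers of the concave function
`h y = ∑ j, g (y ⊓ j e)`, where `e` is a small fraction of `u`, are close to each other in the
seminorm `y ↦ g |y|`: the concavity defect of `h` dominates `g` of the pieces that bound
`|y' - y|`. -/
theorem exists_map_abs_sub_le_of_antitone {g : E →ₗ[ℝ] ℝ} (hg : ∀ x, 0 ≤ x → 0 ≤ g x) {u : E}
    (hu : 0 ≤ u) {C : ℕ → Set E} (hC : Antitone C) (hne : ∀ n, (C n).Nonempty)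
    (h0 : ∀ n, ∀ y ∈ C n, 0 ≤ y) (hCu : ∀ n, ∀ y ∈ C n, y ≤ u)
    (hmid : ∀ n, ∀ y ∈ C n, ∀ y' ∈ C n, (1 / 2 : ℝ) • (y + y') ∈ C n) {η : ℝ} (hη : 0 < η) :
    ∃ n₀, ∃ y ∈ C n₀, ∀ m ≥ n₀, ∃ y' ∈ C m, g |y' - y| ≤ η := by
  obtain ⟨N, hN⟩ : ∃ N : ℕ, ((N : ℝ) + 1)⁻¹ * g u < η / 4 := by
    have h : Tendsto (fun N : ℕ => ((N : ℝ) + 1)⁻¹ * g u) atTop (𝓝 (0 * g u)) := by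
      refine Tendsto.mul_const _ ?_
      simpa [one_div] using tendsto_one_div_add_atTop_nhds_zero_nat (𝕜 := ℝ)
    rw [zero_mul] at h
    exact (h.eventually (gt_mem_nhds (by positivity))).exists
  set e : E := ((N : ℝ) + 1)⁻¹ • u with he
  have he0 : 0 ≤ e := smul_nonneg (by positivity) hu
  have heN : (N + 1) • e = u := by
    rw [he, ← Nat.cast_smul_eq_nsmul ℝ, smul_smul, Nat.cast_succ,
      mul_inv_cancel₀ (by positivity), one_smul]
  have hge : g e < η / 4 := by rwa [he, map_smul, smul_eq_mul]
  let S : E → E → E := fun y y' =>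
    ∑ j ∈ Finset.range (N + 1 + 1), (j • e - y)⁺ ⊓ (y' - j • e)⁺
  let h : E → ℝ := fun y => ∑ j ∈ Finset.range (N + 1 + 1), g (y ⊓ j • e)
  have hgap : ∀ y y', g (S y y') + h y + h y' ≤ 2 * h ((1 / 2 : ℝ) • (y + y')) := by
    intro y y'
    simp only [S, h, map_sum, Finset.mul_sum, ← Finset.sum_add_distrib]
    refine Finset.sum_le_sum fun j _ => ?_
    have h1 := map_le_map_of_nonneg hg (inf_posPart_add_le (j • e) y y')
    rw [map_add, map_add] at h1
    refine h1.trans ?_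
    rw [← smul_eq_mul, ← map_smul]
    refine map_le_map_of_nonneg hg ?_
    rw [← inv_smul_le_iff_of_pos (by norm_num : (0 : ℝ) < 2)]
    refine le_inf ?_ ?_
    · rw [inv_smul_le_iff_of_pos (by norm_num : (0 : ℝ) < 2), smul_smul (2 : ℝ),
        mul_one_div_cancel two_ne_zero, one_smul]
      exact inf_le_left
    · rw [inv_smul_le_iff_of_pos (by norm_num : (0 : ℝ) < 2), ofNat_smul_eq_nsmul ℝ 2]
      exact inf_le_right
  have hh0 : ∀ y, 0 ≤ y → 0 ≤ h y := fun y hy =>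
    Finset.sum_nonneg fun j _ => hg _ (le_inf hy (nsmul_nonneg he0 j))
  have hhu : ∀ y, y ≤ u → h y ≤ h u := fun y hy =>
    Finset.sum_le_sum fun j _ => map_le_map_of_nonneg hg (inf_le_inf_right _ hy)
  set d : ℕ → ℝ := fun n => sSup (h '' C n) with hd
  have hbdd : ∀ n, BddAbove (h '' C n) := by
    rintro n
    refine ⟨h u, ?_⟩
    rintro _ ⟨y, hy, rfl⟩
    exact hhu y (hCu n y hy)
  have hled : ∀ n, ∀ y ∈ C n, h y ≤ d n := fun n y hy => le_csSup (hbdd n) ⟨y, hy, rfl⟩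
  have hd0 : ∀ n, 0 ≤ d n := fun n => by
    obtain ⟨y, hy⟩ := hne n
    exact (hh0 y (h0 n y hy)).trans (hled n y hy)
  have hdbdd : BddBelow (Set.range d) := ⟨0, by rintro _ ⟨n, rfl⟩; exact hd0 n⟩
  -- the concavity gap below is at most `4 τ`, and it enters the estimate of `g |y' - y|` with
  -- total weight `4`; together with `2 g e < η / 2` this gives `η`
  set τ : ℝ := η / 32 with hτ
  have hτ0 : 0 < τ := by positivity
  have hnear : ∀ n, ∃ y ∈ C n, (⨅ n, d n) - τ < h y := by
    intro n
    obtain ⟨_, ⟨y, hy, rfl⟩, hlt⟩ := exists_lt_of_lt_csSup ((hne n).image h)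
      (sub_lt_self (d n) hτ0)
    exact ⟨y, hy, (sub_le_sub_right (ciInf_le hdbdd n) τ).trans_lt hlt⟩
  obtain ⟨n₀, hn₀⟩ := exists_lt_of_ciInf_lt (lt_add_of_pos_right (⨅ n, d n) hτ0)
  obtain ⟨y, hy, hhy⟩ := hnear n₀
  refine ⟨n₀, y, hy, fun m hm => ?_⟩
  obtain ⟨y', hy', hhy'⟩ := hnear m
  refine ⟨y', hy', ?_⟩
  have hy'₀ := hC hm hy'
  have hmidle := hled n₀ _ (hmid n₀ y hy y' hy'₀)
  have hS₁ := hgap y y'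
  have hS₂ := hgap y' y
  rw [add_comm y' y] at hS₂
  have hS0 : ∀ a b, 0 ≤ S a b := fun a b =>
    Finset.sum_nonneg fun j _ => le_inf (posPart_nonneg _) (posPart_nonneg _)
  have hb : ∀ a ∈ C n₀, ∀ b ∈ C n₀, b - a ≤ 2 • e + 2 • S a b := fun a ha b hb =>
    sub_le_two_nsmul_add_sum_inf he0 (N + 1) (h0 _ a ha) (h0 _ b hb) (heN ▸ hCu _ a ha)
      (heN ▸ hCu _ b hb)
  have habs : |y' - y| ≤ 2 • e + 2 • (S y y' + S y' y) := by
    refine abs_le'.2 ⟨(hb y hy y' hy'₀).trans ?_, ?_⟩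
    · gcongr; exact le_add_of_nonneg_right (hS0 _ _)
    · rw [neg_sub]
      refine (hb y' hy'₀ y hy).trans ?_
      gcongr; exact le_add_of_nonneg_left (hS0 _ _)
  have hfin := map_le_map_of_nonneg hg habs
  simp only [map_add, map_nsmul, nsmul_eq_mul, Nat.cast_ofNat] at hfin
  linarith

/-- The analytic core of the theorem: smallness on order bounded disjoint sequences yields weak
compactness of the images of almost order bounded sets. -/
theorem isRelativelyWeaklyCompact_image_of_isAlmostOrderBounded [CompleteSpace E] [CompleteSpace F]
    {T : E →ₗ[ℝ] F} (hT : ∀ x, 0 ≤ x → 0 ≤ T x)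
    (hdis : ∀ (u : E) (y : ℕ → E), (∀ n, 0 ≤ y n) → (∀ n, y n ≤ u) →
      (∀ m n, m ≠ n → y m ⊓ y n = 0) → Tendsto (fun n => T (y n)) atTop (𝓝 0))
    {A : Set E} (hA : IsAlmostOrderBounded A) : IsRelativelyWeaklyCompact (T '' A) := by
  by_contra hcon
  let T' : E →L[ℝ] F := ⟨T, continuous_of_map_nonneg T hT⟩
  obtain ⟨δ, hδ, x, f, hx, hf, hge, hzero⟩ :=
    exists_triangular_seq_of_not_isRelativelyWeaklyCompact
      (T'.lipschitz.isBounded_image hA.isBounded) hcon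
  choose a ha hax using hx
  -- the norm-small parts of the points `a n` change the values `f i (T (a n))` by at most `δ / 4`
  set ε : ℝ := δ / (4 * (‖T'‖ + 1)) with hε
  have hK : 0 < ‖T'‖ + 1 := by positivity
  have hε0 : 0 < ε := by positivity
  obtain ⟨u, hu, hdec⟩ := hA.exists_forall_add hε0
  choose c b hc₁ hc₂ hb hcb using fun n => hdec (a n) (ha n)
  have hfb : ∀ i n, |f i (T (b n))| ≤ δ / 4 := by
    intro i n
    have h1 : ‖T' (b n)‖ ≤ δ / 4 := by
      refine (T'.le_opNorm _).trans ?_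
      calc ‖T'‖ * ‖b n‖ ≤ (‖T'‖ + 1) * ε := by gcongr; exacts [by simp, hb n]
        _ = δ / 4 := by rw [hε]; field_simp
    refine ((f i).le_opNorm _).trans ((mul_le_mul (hf i) h1 (norm_nonneg _) zero_le_one).trans ?_)
    rw [one_mul]
  have hfx : ∀ i n, f i (x n) = f i (T (c n)) + f i (T (b n)) := by
    intro i n
    rw [← hax, hcb, ← map_add, ← map_add]
    rfl
  choose G hG hfG hGle using fun i => exists_nonneg_dominating_functional (f i)
  have hG2 : ∀ i z, 0 ≤ z → G i z ≤ 2 * ‖z‖ := by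
    intro i z hz
    refine (hGle i z hz).trans ?_
    have := hf i
    gcongr
    linarith
  obtain ⟨η, hη, I, hI⟩ := exists_uniform_bound_of_finite_bound hT (u := u + u)
    (fun x hx h0 hxu => cauchySeq_map_of_monotone hT (hdis (u + u)) hx h0 hxu) hG two_pos hG2
    (show 0 < δ / 8 by positivity)
  let g : E →ₗ[ℝ] ℝ := ∑ j ∈ Finset.range (I + 1), (G j).comp T
  have hgap : ∀ z, g z = ∑ j ∈ Finset.range (I + 1), G j (T z) := fun z => by
    simp [g, LinearMap.sum_apply]
  have hg : ∀ z, 0 ≤ z → 0 ≤ g z := fun z hz => by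
    rw [hgap]
    exact Finset.sum_nonneg fun j _ => hG j _ (hT z hz)
  -- the order interval `[-u, u]` is translated to `[0, u + u]`; the sets `C n` retain, in a convex
  -- form, both halves of the triangular pattern of the values `f i (x n)`
  let C : ℕ → Set E := fun n => {z | 0 ≤ z ∧ z ≤ u + u ∧
    (∀ i ≤ n, 3 * δ / 4 ≤ f i (T (z - u))) ∧ ∃ M, ∀ m ≥ M, f m (T (z - u)) ≤ δ / 4}
  have hCanti : Antitone C := fun n n' hn z hz =>
    ⟨hz.1, hz.2.1, fun i hi => hz.2.2.1 i (hi.trans hn), hz.2.2.2⟩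
  have hCne : ∀ n, (C n).Nonempty := by
    intro n
    refine ⟨c n + u, neg_le_iff_add_nonneg.1 (hc₁ n), add_le_add_left (hc₂ n) u, ?_, n + 1, ?_⟩
    · intro i hi
      rw [add_sub_cancel_right]
      have h1 := hge i n hi
      have h2 := (abs_le.1 (hfb i n)).2
      rw [hfx] at h1
      linarith
    · intro m hm
      rw [add_sub_cancel_right]
      have h1 := hzero m n hm
      have h2 := (abs_le.1 (hfb m n)).1
      rw [hfx] at h1
      linarith
  have hCmid : ∀ n, ∀ z ∈ C n, ∀ z' ∈ C n, (1 / 2 : ℝ) • (z + z') ∈ C n := by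
    rintro n z ⟨hz₁, hz₂, hz₃, M, hM⟩ z' ⟨hz₁', hz₂', hz₃', M', hM'⟩
    have hval : ∀ i, f i (T ((1 / 2 : ℝ) • (z + z') - u)) =
        (f i (T (z - u)) + f i (T (z' - u))) / 2 := by
      intro i
      simp only [map_sub, map_smul, map_add, smul_eq_mul]
      ring
    refine ⟨smul_nonneg (by norm_num) (add_nonneg hz₁ hz₁'), ?_, fun i hi => ?_, max M M',
      fun m hm => ?_⟩
    · calc (1 / 2 : ℝ) • (z + z') ≤ (1 / 2 : ℝ) • ((u + u) + (u + u)) :=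
            smul_le_smul_of_nonneg_left (add_le_add hz₂ hz₂') (by norm_num)
        _ = u + u := by rw [← two_smul ℝ (u + u), smul_smul]; norm_num
    · rw [hval]
      linarith [hz₃ i hi, hz₃' i hi]
    · rw [hval]
      linarith [hM m ((le_max_left _ _).trans hm), hM' m ((le_max_right _ _).trans hm)]
  obtain ⟨n₀, y, hy, hyC⟩ := exists_map_abs_sub_le_of_antitone hg (add_nonneg hu hu) hCanti hCne
    (fun n z hz => hz.1) (fun n z hz => hz.2.1) hCmid hη
  obtain ⟨M, hM⟩ := hy.2.2.2
  obtain ⟨y', hy', hyη⟩ := hyC (max n₀ M) (le_max_left _ _)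
  -- at the index `m`, the value of `y` is at most `δ / 4` and that of `y'` at least `3 δ / 4`,
  -- although `g |y' - y| ≤ η` keeps them within `δ / 8` of each other
  set m := max n₀ M
  have h1 := hM m (le_max_right _ _)
  have h2 := hy'.2.2.1 m le_rfl
  have hw : |y' - y| ≤ u + u := abs_le'.2 ⟨(sub_le_self _ hy.1).trans hy'.2.1, by
    rw [neg_sub]; exact (sub_le_self _ hy'.1).trans hy.2.1⟩
  have h3 := hI |y' - y| (abs_nonneg _) hw (fun j hj => by
    refine le_trans ?_ hyη
    rw [hgap]
    exact Finset.single_le_sum (f := fun j => G j (T |y' - y|))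
      (fun k _ => hG k _ (hT _ (abs_nonneg _))) (Finset.mem_range.2 (Nat.lt_succ_of_le hj))) m
  have h4 : f m (T (y' - y)) ≤ δ / 8 :=
    (le_abs_self _).trans ((hfG m _).trans
      ((map_le_map_of_nonneg (hG m) (abs_map_le_map_abs hT _)).trans h3))
  have h5 : f m (T (y' - y)) = f m (T (y' - u)) - f m (T (y - u)) := by
    rw [← map_sub, ← map_sub, sub_sub_sub_cancel_right]
  linarith

/-- The partial sums of a disjoint sequence in `[0, u]` increase within `[0, u]`, so their images
converge in norm and the increments tend to zero. -/
theorem tendsto_map_of_disjoint_of_isRelativelyWeaklyCompact {T : E →ₗ[ℝ] F}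
    (hT : ∀ x, 0 ≤ x → 0 ≤ T x) {u : E} (hu : IsRelativelyWeaklyCompact (T '' Set.Icc (-u) u))
    {y : ℕ → E} (h0 : ∀ n, 0 ≤ y n) (hyu : ∀ n, y n ≤ u)
    (hd : ∀ m n, m ≠ n → y m ⊓ y n = 0) : Tendsto (fun n => T (y n)) atTop (𝓝 0) := by
  have hu0 : 0 ≤ u := (h0 0).trans (hyu 0)
  set s : ℕ → E := fun N => ∑ k ∈ Finset.range N, y k
  have hs : Monotone s := monotone_nat_of_le_succ fun N => by
    simp only [s, Finset.sum_range_succ]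
    exact le_add_of_nonneg_right (h0 N)
  obtain ⟨a, ha⟩ := exists_tendsto_of_monotone_of_isRelativelyWeaklyCompact hu
    (z := fun N => T (s N)) (fun N M h => map_le_map_of_nonneg hT (hs h)) fun N =>
      ⟨s N, ⟨(neg_nonpos.2 hu0).trans (Finset.sum_nonneg fun k _ => h0 k),
        sum_range_le_of_disjoint h0 hyu hd N⟩, rfl⟩
  have h := (ha.comp (tendsto_add_atTop_nat 1)).sub ha
  rw [sub_self] at h
  refine h.congr fun N => ?_
  simp [s, Finset.sum_range_succ]

/-- Almost order bounded disjoint sequences reduce to order bounded ones through `|x n| ⊓ u`, since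
`|x n| - |x n| ⊓ u = (|x n| - u)⁺` is uniformly small in norm. -/
theorem tendsto_map_of_isDisjointSeq_of_isAlmostOrderBounded [CompleteSpace E] {T : E →ₗ[ℝ] F}
    (hT : ∀ x, 0 ≤ x → 0 ≤ T x)
    (hdis : ∀ (u : E) (y : ℕ → E), (∀ n, 0 ≤ y n) → (∀ n, y n ≤ u) →
      (∀ m n, m ≠ n → y m ⊓ y n = 0) → Tendsto (fun n => T (y n)) atTop (𝓝 0))
    {x : ℕ → E} (hx : IsDisjointSeq x) (hxb : IsAlmostOrderBounded (Set.range x)) :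
    Tendsto (fun n => T (x n)) atTop (𝓝 0) := by
  let T' : E →L[ℝ] F := ⟨T, continuous_of_map_nonneg T hT⟩
  rw [Metric.tendsto_atTop]
  intro ε hε
  have hK : 0 < ‖T'‖ + 1 := by positivity
  obtain ⟨u, hu, hdec⟩ := hxb.exists_forall_add (show 0 < ε / (2 * (‖T'‖ + 1)) by positivity)
  have h1 := hdis u (fun n => |x n| ⊓ u) (fun n => le_inf (abs_nonneg _) hu)
    (fun n => inf_le_right) fun m n hmn => le_antisymm
      ((inf_le_inf inf_le_left inf_le_left).trans (hx m n hmn).le)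
      (le_inf (le_inf (abs_nonneg _) hu) (le_inf (abs_nonneg _) hu))
  obtain ⟨N, hN⟩ := Metric.tendsto_atTop.1 h1 (ε / 2) (half_pos hε)
  refine ⟨N, fun n hn => ?_⟩
  have h2 := hN n hn
  rw [dist_zero_right] at h2 ⊢
  obtain ⟨c, b, hc₁, hc₂, hb, hcb⟩ := hdec (x n) ⟨n, rfl⟩
  have h3 : ‖(|x n| - u)⁺‖ ≤ ε / (2 * (‖T'‖ + 1)) := by
    refine le_trans ?_ hb
    rw [← norm_abs_eq_norm b]
    refine norm_le_norm_of_nonneg_of_le (posPart_nonneg _) (sup_le ?_ (abs_nonneg b))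
    rw [sub_le_iff_le_add', hcb]
    exact (abs_add_le c b).trans (add_le_add_left (abs_le'.2 ⟨hc₂, neg_le.1 hc₁⟩) _)
  have h4 : |x n| = |x n| ⊓ u + (|x n| - u)⁺ := by
    rw [inf_eq_sub_posPart_sub, sub_add_cancel]
  calc ‖T (x n)‖ ≤ ‖T |x n|‖ :=
        norm_le_norm_of_abs_le_abs ((abs_map_le_map_abs hT _).trans (le_abs_self _))
    _ = ‖T (|x n| ⊓ u) + T' ((|x n| - u)⁺)‖ := by
        conv_lhs => rw [h4, map_add]
        rfl
    _ ≤ ‖T (|x n| ⊓ u)‖ + ‖T'‖ * ‖(|x n| - u)⁺‖ :=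
        (norm_add_le _ _).trans (by gcongr; exact T'.le_opNorm _)
    _ ≤ ‖T (|x n| ⊓ u)‖ + (‖T'‖ + 1) * (ε / (2 * (‖T'‖ + 1))) := by
        gcongr
        simp
    _ < ε / 2 + ε / 2 := by
        have : (‖T'‖ + 1) * (ε / (2 * (‖T'‖ + 1))) = ε / 2 := by field_simp
        rw [this]
        gcongr
    _ = ε := add_halves ε

end AlmostOrderBounded

/-! ### Almost order-weakly compact operators -/

theorem mainTheorem1 {E F : Type*}
    [NormedAddCommGroup E] [Lattice E] [IsOrderedAddMonoid E] [HasSolidNorm E]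
    [NormedSpace ℝ E] [IsOrderedModule ℝ E] [CompleteSpace E]
    [NormedAddCommGroup F] [Lattice F] [IsOrderedAddMonoid F] [HasSolidNorm F]
    [NormedSpace ℝ F] [IsOrderedModule ℝ F] [CompleteSpace F]
    (hF : IsDedekindComplete F)
    (T : E →ₗ[ℝ] F) (hT : ∀ x : E, 0 ≤ x → 0 ≤ T x) :
    IsAlmostOrderWeaklyCompact T ↔
      ∀ x : ℕ → E, IsDisjointSeq x → IsAlmostOrderBounded (Set.range x) →
        Tendsto (fun n => T (x n)) atTop (𝓝 0) := by
  refine ⟨fun h x hx hxb => ?_, fun h => ⟨continuous_of_map_nonneg T hT, fun A hA => ?_⟩⟩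
  · refine tendsto_map_of_isDisjointSeq_of_isAlmostOrderBounded hT (fun u y h0 hyu hd => ?_) hx hxb
    exact tendsto_map_of_disjoint_of_isRelativelyWeaklyCompact hT
      (h.2 _ (.of_subset_Icc ((h0 0).trans (hyu 0)) subset_rfl)) h0 hyu hd
  · refine isRelativelyWeaklyCompact_image_of_isAlmostOrderBounded hT (fun u y h0 hyu hd => ?_) hA
    have hu : 0 ≤ u := (h0 0).trans (hyu 0)
    refine h y (fun m n hmn => ?_) (.of_subset_Icc hu ?_)
    · rw [abs_of_nonneg (h0 m), abs_of_nonneg (h0 n), hd m n hmn]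
    · rintro _ ⟨n, rfl⟩
      exact ⟨(neg_nonpos.2 hu).trans (h0 n), hyu n⟩
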